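/- Let $A\in\mathbb{R}^{m\times n}$ with $m<n$ have full row rank, let $b\in\mathbb{R}^m$, $c\in\mathbb{R}^n$, and consider the linear program $\min c^Tx$ subject to $Ax=b$, $x\ge 0$, whose feasible set $P$ is assumed to be bounded. A feasible basis is a choice of $m$ columns of $A$ forming an invertible matrix $B$ with $B^{-1}b\ge 0$; its basic feasible solution (BFS) has basic coordinates $x_B=B^{-1}b$ and nonbasic coordinates $0$. For a nonbasic column $q$ let the edge $\eta^q\in\mathbb{R}^n$ be the vector with entry $1$ at $q$, entries $-B^{-1}A_q$ at the basic coordinates and entries $0$ at the other nonbasic coordinates, with Euclidean norm $\zeta^q=\|\eta^q\|_2$ and reduced cost $\bar c^q=c^T\eta^q$. The steepest-edge simplex method starts at an arbitrary feasible basis. As long as some reduced cost is negative, it lets a nonbasic column $q$ minimizing $\bar c^q/\zeta^q$ enter the basis, and lets a basic variable chosen by the ratio test leave it (ties are broken arbitrarily). A pivot is nondegenerate if it changes the BFS. Assume that the BFS have a positive coordinate (i.e. $b\neq 0$), let $\gamma$ and $\delta$ be the maximum and the minimum of the positive coordinates of all BFS, and let $\nu$ and $\mu$ be the maximum and the minimum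 of the edge norms $\zeta^q$ over all feasible bases and all their nonbasic columns $q$. Put $$K=\max\Bigl\{1,\Bigl\lceil \frac{m\gamma\nu}{\delta\mu}\log\Bigl(\frac{m\gamma}{\delta}\Bigr)\Bigr\rceil\Bigr\}$$ (the maximum with $1$ matters only if $m=1$ and $\gamma=\delta$). Then, in every (finite or infinite) run of the steepest-edge simplex method, at most $nK$ different BFS are generated and at most $nK$ nondegenerate pivots are made. If the linear program is nondegenerate (for every feasible basis, $B^{-1}b>0$), the same two bounds also hold when $\nu$ and $\mu$ are instead the maximum and the minimum of the Euclidean lengths of the edges (one-dimensional faces) of $P$, provided that $P$ has an edge. Moreover (also for $b=0$), whenever the method stops because no further pivot is possible, the current BFS is an optimal solution. -/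

import Mathlib

open scoped Matrix

noncomputable section

namespace StdLP

variable {m n : ℕ}

/-- The feasible polyhedron `{x : A x = b, x ≥ 0}` of the standard-form linear program
`min cᵀ x` subject to `A x = b`, `x ≥ 0`. -/
def feasible (A : Matrix (Fin m) (Fin n) ℝ) (b : Fin m → ℝ) : Set (Fin n → ℝ) :=
  {x | A *ᵥ x = b ∧ ∀ j, 0 ≤ x j}

/-- `x` is an optimal solution of the linear program. -/
def IsOptimal (A : Matrix (Fin m) (Fin n) ℝ) (b : Fin m → ℝ) (c : Fin n → ℝ)
    (x : Fin n → ℝ) : Prop :=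
  x ∈ feasible A b ∧ ∀ y ∈ feasible A b, c ⬝ᵥ x ≤ c ⬝ᵥ y

/-- A choice of `m` columns of `A` is recorded as a map `σ : Fin m → Fin n`; this is the square
matrix `B` of the chosen columns. -/
def basisMatrix (A : Matrix (Fin m) (Fin n) ℝ) (σ : Fin m → Fin n) :
    Matrix (Fin m) (Fin m) ℝ :=
  A.submatrix id σ

/-- The vector of `ℝⁿ` whose coordinate `σ i` is `v i` and whose other coordinates are `0`
(used for injective `σ`, which every basis is). -/
def extendByZero (σ : Fin m → Fin n) (v : Fin m → ℝ) : Fin n → ℝ :=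
  fun j => ∑ i, if σ i = j then v i else 0

/-- The values `x_B = B⁻¹ b` of the basic variables. -/
def basicValues (A : Matrix (Fin m) (Fin n) ℝ) (b : Fin m → ℝ) (σ : Fin m → Fin n) :
    Fin m → ℝ :=
  (basisMatrix A σ)⁻¹ *ᵥ b

/-- The basic solution `x_B = B⁻¹ b`, `x_N = 0`. -/
def basicSolution (A : Matrix (Fin m) (Fin n) ℝ) (b : Fin m → ℝ) (σ : Fin m → Fin n) :
    Fin n → ℝ :=
  extendByZero σ (basicValues A b σ)

/-- `σ` is a feasible basis: `B` is invertible and `B⁻¹ b ≥ 0`. -/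
def IsFeasibleBasis (A : Matrix (Fin m) (Fin n) ℝ) (b : Fin m → ℝ) (σ : Fin m → Fin n) : Prop :=
  IsUnit (basisMatrix A σ).det ∧ ∀ i, 0 ≤ basicValues A b σ i

/-- `x` is a basic feasible solution. -/
def IsBFS (A : Matrix (Fin m) (Fin n) ℝ) (b : Fin m → ℝ) (x : Fin n → ℝ) : Prop :=
  ∃ σ, IsFeasibleBasis A b σ ∧ x = basicSolution A b σ

/-- The linear program is nondegenerate: all basic variables of all feasible bases are positive. -/
def Nondegenerate (A : Matrix (Fin m) (Fin n) ℝ) (b : Fin m → ℝ) : Prop :=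
  ∀ σ, IsFeasibleBasis A b σ → ∀ i, 0 < basicValues A b σ i

/-- The column `q` is nonbasic for `σ`. -/
def IsNonbasic (σ : Fin m → Fin n) (q : Fin n) : Prop :=
  ∀ i, σ i ≠ q

/-- The vector `B⁻¹ A_q`. -/
def tableauColumn (A : Matrix (Fin m) (Fin n) ℝ) (σ : Fin m → Fin n) (q : Fin n) : Fin m → ℝ :=
  (basisMatrix A σ)⁻¹ *ᵥ (fun k => A k q)

/-- The edge direction `η^q` of the nonbasic column `q`: it is `1` at `q`, `-B⁻¹ A_q` on the basic
coordinates, and `0` at the other nonbasic coordinates. -/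
def edgeDirection (A : Matrix (Fin m) (Fin n) ℝ) (σ : Fin m → Fin n) (q : Fin n) : Fin n → ℝ :=
  Pi.single q 1 - extendByZero σ (tableauColumn A σ q)

/-- The Euclidean norm `ζ^q` of the edge direction `η^q`. -/
def edgeNorm (A : Matrix (Fin m) (Fin n) ℝ) (σ : Fin m → Fin n) (q : Fin n) : ℝ :=
  ‖WithLp.toLp 2 (edgeDirection A σ q)‖

/-- The reduced cost `cᵀ η^q = c_q - c_Bᵀ B⁻¹ A_q` of the nonbasic column `q`. -/
def reducedCost (A : Matrix (Fin m) (Fin n) ℝ) (c : Fin n → ℝ) (σ : Fin m → Fin n)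
    (q : Fin n) : ℝ :=
  c ⬝ᵥ edgeDirection A σ q

/-- The steepest-edge rule may choose `q` to enter the basis: the reduced cost of `q` is negative,
and `q` minimizes the normalized reduced cost over all nonbasic columns. -/
def SteepestEdgeEntering (A : Matrix (Fin m) (Fin n) ℝ) (c : Fin n → ℝ) (σ : Fin m → Fin n)
    (q : Fin n) : Prop :=
  IsNonbasic σ q ∧ reducedCost A c σ q < 0 ∧
    ∀ r, IsNonbasic σ r → reducedCost A c σ q / edgeNorm A σ q ≤ reducedCost A c σ r / edgeNorm A σ r

/-- The basic variable in position `i` may leave the basis when `q` enters (ratio test). -/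
def RatioTestLeaving (A : Matrix (Fin m) (Fin n) ℝ) (b : Fin m → ℝ) (σ : Fin m → Fin n)
    (q : Fin n) (i : Fin m) : Prop :=
  0 < tableauColumn A σ q i ∧
    ∀ k, 0 < tableauColumn A σ q k →
      basicValues A b σ i / tableauColumn A σ q i ≤ basicValues A b σ k / tableauColumn A σ q k

/-- One pivot of the steepest-edge simplex method, with ties broken arbitrarily. -/
def SteepestEdgePivot (A : Matrix (Fin m) (Fin n) ℝ) (b : Fin m → ℝ) (c : Fin n → ℝ)
    (σ σ' : Fin m → Fin n) : Prop :=
  ∃ q i, SteepestEdgeEntering A c σ q ∧ RatioTestLeaving A b σ q i ∧ σ' = Function.update σ i q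

/-- The bases `s 0, …, s T` are the first ones generated by a run of the steepest-edge simplex
method from the arbitrary feasible basis `s 0`. -/
def IsSteepestEdgeRun (A : Matrix (Fin m) (Fin n) ℝ) (b : Fin m → ℝ) (c : Fin n → ℝ)
    (T : ℕ) (s : ℕ → Fin m → Fin n) : Prop :=
  IsFeasibleBasis A b (s 0) ∧ ∀ t < T, SteepestEdgePivot A b c (s t) (s (t + 1))

/-- The basic feasible solutions generated in the run `s 0, …, s T`. -/
def generatedBFS (A : Matrix (Fin m) (Fin n) ℝ) (b : Fin m → ℝ)
    (T : ℕ) (s : ℕ → Fin m → Fin n) : Set (Fin n → ℝ) :=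
  {x | ∃ t ≤ T, x = basicSolution A b (s t)}

/-- The times of the nondegenerate pivots of the run, those which change the current solution. -/
def nondegeneratePivots (A : Matrix (Fin m) (Fin n) ℝ) (b : Fin m → ℝ)
    (T : ℕ) (s : ℕ → Fin m → Fin n) : Set ℕ :=
  {t | t < T ∧ basicSolution A b (s (t + 1)) ≠ basicSolution A b (s t)}

/-- The positive coordinates of all basic feasible solutions. -/
def positiveBFSCoords (A : Matrix (Fin m) (Fin n) ℝ) (b : Fin m → ℝ) : Set ℝ :=
  {r | ∃ x j, IsBFS A b x ∧ r = x j ∧ 0 < r}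

/-- The Euclidean norms of all edges `η^q` at all feasible bases. -/
def edgeNorms (A : Matrix (Fin m) (Fin n) ℝ) (b : Fin m → ℝ) : Set ℝ :=
  {r | ∃ σ q, IsFeasibleBasis A b σ ∧ IsNonbasic σ q ∧ r = edgeNorm A σ q}

/-- The Euclidean lengths of all edges (one-dimensional faces) of the feasible polytope. -/
def polytopeEdgeLengths (A : Matrix (Fin m) (Fin n) ℝ) (b : Fin m → ℝ) : Set ℝ :=
  {r | ∃ x y, x ≠ y ∧ IsExtreme ℝ (feasible A b) (segment ℝ x y) ∧
    r = ‖WithLp.toLp 2 (x - y)‖}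

/-- The bound `n ⌈(mγν/(δμ)) log (mγ/δ)⌉`, where the rounded factor counts as `1` when it is `0`
(for positive arguments with `δ ≤ γ` and `1 ≤ m` this happens only if `m = 1` and `γ = δ`). -/
def steepestEdgeBound (m n : ℕ) (γ δ ν μ : ℝ) : ℕ :=
  n * max 1 ⌈(m * γ * ν) / (δ * μ) * Real.log (m * γ / δ)⌉₊

end StdLP

end

open scoped Matrix

namespace StdLP

variable {m n : ℕ}

/-! ### Bases, edge directions and pivots. -/

section Basis

variable {A : Matrix (Fin m) (Fin n) ℝ} {b : Fin m → ℝ} {c : Fin n → ℝ} {σ : Fin m → Fin n}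
  {q : Fin n}

/-! Let `z` be an optimal BFS. The proof weighs a contraction of the gap `c ⬝ᵥ x - c ⬝ᵥ z` against a
lower bound for it.

Contraction (`gap_update_le`): let `Δ` be the steepest descent per unit Euclidean length. If all
edge norms are at most `L`, every reduced cost is at least `-Δ L`. Expanding `z` along the edge
directions, with coordinate sum at most `m γ`, bounds the gap by `Δ m γ L`. A nondegenerate pivot of
Euclidean length at least `M` gains at least `Δ M`, so it multiplies the gap by at most `1 - ρ`,
where `ρ = M / (m γ L)`.

Lower bound (`exists_dual_slack`): the gap is `w ⬝ᵥ x` for a dual slack `w ≥ 0`. Label each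
nondegenerate pivot by a coordinate that carries at least `1/m` of the gap. If two pivots share the
label `j`, the earlier gap is at most `m γ w j` and the later one at least `δ w j`. Once `(1 - ρ) ^
K < δ / (m γ)`, a label is thus used at most `K` times (`card_le_of_contraction`). A positive
coordinate of `z` has zero slack and is never a label, so there are at most `K (n - 1)`
nondegenerate pivots, and the starting BFS adds one solution.

The two versions of the bound differ only in the choice of `L` and `M`. -/

theorem extendByZero_of_isNonbasic (hq : IsNonbasic σ q) (v : Fin m → ℝ) :
    extendByZero σ v q = 0 :=
  Finset.sum_eq_zero fun i _ => if_neg (hq i)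

theorem extendByZero_apply (hσ : Function.Injective σ) (v : Fin m → ℝ) (i : Fin m) :
    extendByZero σ v (σ i) = v i := by
  simp [extendByZero, hσ.eq_iff]

theorem mulVec_extendByZero (A : Matrix (Fin m) (Fin n) ℝ) (σ : Fin m → Fin n) (v : Fin m → ℝ) :
    A *ᵥ extendByZero σ v = basisMatrix A σ *ᵥ v := by
  ext k
  simp only [Matrix.mulVec, dotProduct, extendByZero, basisMatrix, Matrix.submatrix_apply, id,
    Finset.mul_sum, mul_ite, mul_zero]
  rw [Finset.sum_comm]
  simp

theorem injective_of_isUnit_det (hσ : IsUnit (basisMatrix A σ).det) : Function.Injective σ := by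
  intro i j hij
  by_contra hne
  refine hσ.ne_zero (Matrix.det_zero_of_column_eq hne fun k => ?_)
  simp [basisMatrix, hij]

theorem eq_extendByZero (hσ : Function.Injective σ) {z : Fin n → ℝ}
    (hz : ∀ j, IsNonbasic σ j → z j = 0) : z = extendByZero σ (z ∘ σ) := by
  ext j
  by_cases hj : IsNonbasic σ j
  · rw [hz j hj, extendByZero_of_isNonbasic hj]
  · simp only [IsNonbasic, not_forall, not_not] at hj
    obtain ⟨i, rfl⟩ := hj
    rw [extendByZero_apply hσ, Function.comp_apply]

/-- Such a `z` solves the invertible system `B z_B = 0`. Hence vectors with the same image under `A`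
may be compared on nonbasic coordinates alone. -/
theorem eq_zero_of_mulVec_eq_zero (hσ : IsUnit (basisMatrix A σ).det) {z : Fin n → ℝ}
    (hAz : A *ᵥ z = 0) (hz : ∀ j, IsNonbasic σ j → z j = 0) : z = 0 := by
  have hz' := eq_extendByZero (injective_of_isUnit_det hσ) hz
  rw [hz', mulVec_extendByZero] at hAz
  have h0 : z ∘ σ = 0 := by
    rw [← Matrix.one_mulVec (z ∘ σ), ← Matrix.nonsing_inv_mul _ hσ, ← Matrix.mulVec_mulVec, hAz,
      Matrix.mulVec_zero]
  rw [hz', h0]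
  ext j
  simp [extendByZero]

theorem mulVec_basicSolution (hσ : IsUnit (basisMatrix A σ).det) :
    A *ᵥ basicSolution A b σ = b := by
  rw [basicSolution, mulVec_extendByZero, basicValues, Matrix.mulVec_mulVec,
    Matrix.mul_nonsing_inv _ hσ, Matrix.one_mulVec]

theorem mulVec_edgeDirection (hσ : IsUnit (basisMatrix A σ).det) (q : Fin n) :
    A *ᵥ edgeDirection A σ q = 0 := by
  rw [edgeDirection, Matrix.mulVec_sub, mulVec_extendByZero, tableauColumn, Matrix.mulVec_mulVec,
    Matrix.mul_nonsing_inv _ hσ, Matrix.one_mulVec, Matrix.mulVec_single_one]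
  exact sub_self _

theorem edgeDirection_of_isNonbasic {j : Fin n} (hj : IsNonbasic σ j) (q : Fin n) :
    edgeDirection A σ q j = if j = q then 1 else 0 := by
  simp [edgeDirection, extendByZero_of_isNonbasic hj, Pi.single_apply]

theorem edgeDirection_self (hq : IsNonbasic σ q) : edgeDirection A σ q q = 1 := by
  simp [edgeDirection_of_isNonbasic hq]

theorem edgeDirection_basic (hσ : Function.Injective σ) (hq : IsNonbasic σ q) (i : Fin m) :
    edgeDirection A σ q (σ i) = -tableauColumn A σ q i := by
  simp [edgeDirection, extendByZero_apply hσ, hq i]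

/-- This lets the expansions below run over all columns, basic ones included. -/
theorem edgeDirection_eq_zero (hσ : IsUnit (basisMatrix A σ).det) (hq : ¬ IsNonbasic σ q) :
    edgeDirection A σ q = 0 := by
  refine eq_zero_of_mulVec_eq_zero hσ (mulVec_edgeDirection hσ q) fun j hj => ?_
  rw [edgeDirection_of_isNonbasic hj, if_neg]
  rintro rfl
  exact hq hj

theorem basicSolution_of_isNonbasic (hq : IsNonbasic σ q) : basicSolution A b σ q = 0 :=
  extendByZero_of_isNonbasic hq _

theorem basicSolution_basic (hσ : Function.Injective σ) (i : Fin m) :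
    basicSolution A b σ (σ i) = basicValues A b σ i :=
  extendByZero_apply hσ _ i

theorem eq_basicSolution (hσ : IsUnit (basisMatrix A σ).det) {y : Fin n → ℝ} (hy : A *ᵥ y = b)
    (hy0 : ∀ j, IsNonbasic σ j → y j = 0) : y = basicSolution A b σ := by
  refine sub_eq_zero.1 (eq_zero_of_mulVec_eq_zero hσ ?_ fun j hj => ?_)
  · rw [Matrix.mulVec_sub, hy, mulVec_basicSolution hσ, sub_self]
  · rw [Pi.sub_apply, hy0 j hj, basicSolution_of_isNonbasic hj, sub_self]

/-- Subtracting `y q` times each edge direction keeps `A y = b` and clears every nonbasic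
coordinate, which leaves the basic solution. -/
theorem eq_basicSolution_add_sum (hσ : IsUnit (basisMatrix A σ).det) {y : Fin n → ℝ}
    (hy : A *ᵥ y = b) : y = basicSolution A b σ + ∑ q, y q • edgeDirection A σ q := by
  refine sub_eq_iff_eq_add.1 (eq_basicSolution hσ ?_ fun j hj => ?_)
  · rw [Matrix.mulVec_sub, hy, Matrix.mulVec_sum]
    simp [Matrix.mulVec_smul, mulVec_edgeDirection hσ]
  · simp [edgeDirection_of_isNonbasic hj]

theorem dotProduct_eq_add_sum (hσ : IsUnit (basisMatrix A σ).det) (c : Fin n → ℝ) {y : Fin n → ℝ}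
    (hy : A *ᵥ y = b) :
    c ⬝ᵥ y = c ⬝ᵥ basicSolution A b σ + ∑ q, y q * reducedCost A c σ q := by
  conv_lhs => rw [eq_basicSolution_add_sum hσ hy]
  simp [dotProduct_add, dotProduct_sum, reducedCost]

theorem basicSolution_nonneg (hσ : IsFeasibleBasis A b σ) (j : Fin n) :
    0 ≤ basicSolution A b σ j := by
  unfold basicSolution extendByZero
  refine Finset.sum_nonneg fun i _ => ?_
  split_ifs
  exacts [hσ.2 i, le_rfl]

theorem basicSolution_mem_feasible (hσ : IsFeasibleBasis A b σ) :
    basicSolution A b σ ∈ feasible A b :=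
  ⟨mulVec_basicSolution hσ.1, basicSolution_nonneg hσ⟩

theorem isOptimal_of_reducedCost_nonneg (hσ : IsFeasibleBasis A b σ)
    (h : ∀ q, IsNonbasic σ q → 0 ≤ reducedCost A c σ q) :
    IsOptimal A b c (basicSolution A b σ) := by
  refine ⟨basicSolution_mem_feasible hσ, fun y hy => ?_⟩
  rw [dotProduct_eq_add_sum hσ.1 c hy.1]
  refine le_add_of_nonneg_right (Finset.sum_nonneg fun q _ => mul_nonneg (hy.2 q) ?_)
  by_cases hq : IsNonbasic σ q
  · exact h q hq
  · simp [reducedCost, edgeDirection_eq_zero hσ.1 hq]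

theorem add_smul_edgeDirection_mem_feasible (hσ : IsFeasibleBasis A b σ) (hq : IsNonbasic σ q)
    {t : ℝ} (ht : 0 ≤ t) (h : ∀ i, t * tableauColumn A σ q i ≤ basicValues A b σ i) :
    basicSolution A b σ + t • edgeDirection A σ q ∈ feasible A b := by
  have hinj := injective_of_isUnit_det hσ.1
  refine ⟨?_, fun j => ?_⟩
  · rw [Matrix.mulVec_add, Matrix.mulVec_smul, mulVec_basicSolution hσ.1,
      mulVec_edgeDirection hσ.1, smul_zero, add_zero]
  · by_cases hj : IsNonbasic σ j
    · rw [Pi.add_apply, Pi.smul_apply, basicSolution_of_isNonbasic hj,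
        edgeDirection_of_isNonbasic hj]
      split_ifs <;> simp [ht]
    · simp only [IsNonbasic, not_forall, not_not] at hj
      obtain ⟨i, rfl⟩ := hj
      rw [Pi.add_apply, Pi.smul_apply, basicSolution_basic hinj, edgeDirection_basic hinj hq,
        smul_eq_mul]
      linarith [h i]

/-- Otherwise the whole ray along the edge direction is feasible, and its coordinate `q` is
unbounded. -/
theorem exists_tableauColumn_pos (hbdd : Bornology.IsBounded (feasible A b))
    (hσ : IsFeasibleBasis A b σ) (hq : IsNonbasic σ q) : ∃ i, 0 < tableauColumn A σ q i := by
  by_contra! h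
  obtain ⟨R, hR⟩ := isBounded_iff_forall_norm_le.1 hbdd
  have ht : (0 : ℝ) ≤ |R| + 1 := by positivity
  have hmem := add_smul_edgeDirection_mem_feasible hσ hq ht fun i =>
    (mul_nonpos_of_nonneg_of_nonpos ht (h i)).trans (hσ.2 i)
  have h1 := (norm_le_pi_norm _ q).trans (hR _ hmem)
  rw [Pi.add_apply, Pi.smul_apply, basicSolution_of_isNonbasic hq, edgeDirection_self hq, zero_add,
    smul_eq_mul, mul_one, Real.norm_eq_abs, abs_of_nonneg ht] at h1
  linarith [le_abs_self R]

theorem exists_ratioTestLeaving (hbdd : Bornology.IsBounded (feasible A b))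
    (hσ : IsFeasibleBasis A b σ) (hq : IsNonbasic σ q) : ∃ i, RatioTestLeaving A b σ q i := by
  obtain ⟨i₀, hi₀⟩ := exists_tableauColumn_pos hbdd hσ hq
  obtain ⟨i, hi, hmin⟩ := Finset.exists_min_image
    (Finset.univ.filter fun i => 0 < tableauColumn A σ q i)
    (fun i => basicValues A b σ i / tableauColumn A σ q i) ⟨i₀, by simpa using hi₀⟩
  exact ⟨i, by simpa using hi, fun k hk => hmin k (by simpa using hk)⟩

theorem exists_steepestEdgeEntering {r : Fin n} (hr : IsNonbasic σ r)
    (hneg : reducedCost A c σ r < 0) (hpos : ∀ q, IsNonbasic σ q → 0 < edgeNorm A σ q) :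
    ∃ q, SteepestEdgeEntering A c σ q := by
  classical
  obtain ⟨q, hq, hmin⟩ := Finset.exists_min_image
    (Finset.univ.filter fun q => IsNonbasic σ q)
    (fun q => reducedCost A c σ q / edgeNorm A σ q) ⟨r, by simpa using hr⟩
  have hq' : IsNonbasic σ q := by simpa using hq
  refine ⟨q, hq', ?_, fun k hk => hmin k (by simpa using hk)⟩
  have := (hmin r (by simpa using hr)).trans_lt (div_neg_of_neg_of_pos hneg (hpos r hr))
  by_contra! h
  exact this.not_ge (div_nonneg h (hpos q hq').le)

theorem one_le_edgeNorm (hq : IsNonbasic σ q) : 1 ≤ edgeNorm A σ q := by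
  have h := PiLp.norm_apply_le (WithLp.toLp 2 (edgeDirection A σ q)) q
  simpa [edgeNorm, edgeDirection_self hq] using h

theorem isOptimal_of_forall_not_pivot (hbdd : Bornology.IsBounded (feasible A b))
    (hσ : IsFeasibleBasis A b σ) (h : ∀ τ, ¬ SteepestEdgePivot A b c σ τ) :
    IsOptimal A b c (basicSolution A b σ) := by
  refine isOptimal_of_reducedCost_nonneg hσ fun r hr => ?_
  by_contra! hneg
  obtain ⟨q, hq⟩ := exists_steepestEdgeEntering hr hneg fun q hq =>
    zero_lt_one.trans_le (one_le_edgeNorm hq)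
  obtain ⟨i, hi⟩ := exists_ratioTestLeaving hbdd hσ hq.1
  exact h _ ⟨q, i, hq, hi, rfl⟩

/-- Cramer's rule. The ratio test makes the pivot entry positive, so the new basis matrix is again
invertible. -/
theorem det_basisMatrix_update (hσ : IsUnit (basisMatrix A σ).det) (i : Fin m) (q : Fin n) :
    (basisMatrix A (Function.update σ i q)).det =
      (basisMatrix A σ).det * tableauColumn A σ q i := by
  have h := congrFun (Matrix.det_smul_inv_mulVec_eq_cramer (basisMatrix A σ) (fun k => A k q) hσ) i
  rw [Pi.smul_apply, smul_eq_mul, Matrix.cramer_apply] at h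
  rw [tableauColumn, h]
  congr 1
  ext k l
  by_cases hl : l = i
  · subst hl; simp [basisMatrix]
  · simp [basisMatrix, hl]

/-- The step length of the ratio test. -/
noncomputable def stepLength (A : Matrix (Fin m) (Fin n) ℝ) (b : Fin m → ℝ) (σ : Fin m → Fin n)
    (q : Fin n) (i : Fin m) : ℝ :=
  basicValues A b σ i / tableauColumn A σ q i

variable {i : Fin m}

theorem stepLength_nonneg (hσ : IsFeasibleBasis A b σ) (hi : RatioTestLeaving A b σ q i) :
    0 ≤ stepLength A b σ q i :=
  div_nonneg (hσ.2 i) hi.1.le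

theorem stepLength_mul_le (hσ : IsFeasibleBasis A b σ) (hi : RatioTestLeaving A b σ q i)
    (k : Fin m) : stepLength A b σ q i * tableauColumn A σ q k ≤ basicValues A b σ k := by
  rcases lt_or_ge 0 (tableauColumn A σ q k) with hk | hk
  · exact (le_div_iff₀ hk).1 (hi.2 k hk)
  · exact (mul_nonpos_of_nonneg_of_nonpos (stepLength_nonneg hσ hi) hk).trans (hσ.2 k)

theorem isUnit_det_update (hσ : IsFeasibleBasis A b σ) (hi : RatioTestLeaving A b σ q i) :
    IsUnit (basisMatrix A (Function.update σ i q)).det := by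
  rw [det_basisMatrix_update hσ.1]
  exact hσ.1.mul hi.1.ne'.isUnit

/-- The moved point satisfies the equations and vanishes off the new basis: the step length is
chosen to cancel the leaving coordinate. -/
theorem basicSolution_update (hσ : IsFeasibleBasis A b σ) (hq : IsNonbasic σ q)
    (hi : RatioTestLeaving A b σ q i) :
    basicSolution A b (Function.update σ i q) =
      basicSolution A b σ + stepLength A b σ q i • edgeDirection A σ q := by
  have hinj := injective_of_isUnit_det hσ.1
  refine (eq_basicSolution (isUnit_det_update hσ hi) (add_smul_edgeDirection_mem_feasible hσ hq
    (stepLength_nonneg hσ hi) (stepLength_mul_le hσ hi)).1 fun j hj => ?_).symm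
  have hjq : j ≠ q := by
    rintro rfl
    exact hj i (by simp)
  by_cases hj' : IsNonbasic σ j
  · simp [basicSolution_of_isNonbasic hj', edgeDirection_of_isNonbasic hj', hjq]
  · simp only [IsNonbasic, not_forall, not_not] at hj'
    obtain ⟨k, rfl⟩ := hj'
    obtain rfl : k = i := by
      by_contra hk
      exact hj k (by simp [hk])
    have := hi.1.ne'
    rw [Pi.add_apply, Pi.smul_apply, basicSolution_basic hinj, edgeDirection_basic hinj hq,
      smul_eq_mul, stepLength]
    field_simp
    ring

theorem isFeasibleBasis_update (hσ : IsFeasibleBasis A b σ) (hq : IsNonbasic σ q)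
    (hi : RatioTestLeaving A b σ q i) : IsFeasibleBasis A b (Function.update σ i q) := by
  have hu := isUnit_det_update hσ hi
  refine ⟨hu, fun k => ?_⟩
  rw [← basicSolution_basic (injective_of_isUnit_det hu), basicSolution_update hσ hq hi]
  exact (add_smul_edgeDirection_mem_feasible hσ hq (stepLength_nonneg hσ hi)
    (stepLength_mul_le hσ hi)).2 _

theorem basicSolution_update_entering (hσ : IsFeasibleBasis A b σ) (hq : IsNonbasic σ q)
    (hi : RatioTestLeaving A b σ q i) :
    basicSolution A b (Function.update σ i q) q = stepLength A b σ q i := by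
  simp [basicSolution_update hσ hq hi, basicSolution_of_isNonbasic hq, edgeDirection_self hq]

/-- The step length is the entering variable's value in the new BFS, hence itself a BFS coordinate.
-/
theorem le_stepLength {δ : ℝ} (hδ : δ ∈ lowerBounds (positiveBFSCoords A b))
    (hσ : IsFeasibleBasis A b σ) (hq : IsNonbasic σ q) (hi : RatioTestLeaving A b σ q i)
    (hpos : 0 < stepLength A b σ q i) : δ ≤ stepLength A b σ q i :=
  hδ ⟨_, q, ⟨_, isFeasibleBasis_update hσ hq hi, rfl⟩,
    (basicSolution_update_entering hσ hq hi).symm, hpos⟩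

theorem isFeasibleBasis_of_isSteepestEdgeRun {T : ℕ} {s : ℕ → Fin m → Fin n}
    (hs : IsSteepestEdgeRun A b c T s) {t : ℕ} (ht : t ≤ T) : IsFeasibleBasis A b (s t) := by
  induction t with
  | zero => exact hs.1
  | succ t ih =>
    obtain ⟨q, i, hq, hi, h⟩ := hs.2 t ht
    rw [h]
    exact isFeasibleBasis_update (ih (by omega)) hq.1 hi

/-- In a feasible basis, a nonbasic column with positive step length spans an edge of the
feasible polyhedron. -/
theorem isExtreme_segment (hσ : IsFeasibleBasis A b σ) (hq : IsNonbasic σ q)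
    (hi : RatioTestLeaving A b σ q i) (hpos : 0 < stepLength A b σ q i) :
    IsExtreme ℝ (feasible A b) (segment ℝ (basicSolution A b σ +
      stepLength A b σ q i • edgeDirection A σ q) (basicSolution A b σ)) := by
  have hinj := injective_of_isUnit_det hσ.1
  -- The segment is the face where all nonbasic coordinates other than `q` vanish; extremality is
  -- then immediate from nonnegativity.
  have hseg : segment ℝ (basicSolution A b σ + stepLength A b σ q i • edgeDirection A σ q)
      (basicSolution A b σ) = {z | z ∈ feasible A b ∧ ∀ j, IsNonbasic σ j → j ≠ q → z j = 0} := by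
    ext z
    constructor
    · rintro ⟨u, v, hu, hv, huv, rfl⟩
      have hz : u • (basicSolution A b σ + stepLength A b σ q i • edgeDirection A σ q) +
          v • basicSolution A b σ =
          basicSolution A b σ + (u * stepLength A b σ q i) • edgeDirection A σ q := by
        rw [smul_add, add_right_comm, ← add_smul, huv, one_smul, smul_smul]
      rw [hz]
      have hθ := stepLength_nonneg hσ hi
      refine ⟨add_smul_edgeDirection_mem_feasible hσ hq (by positivity) fun k => ?_,
        fun j hj hjq => ?_⟩
      · have h1 := mul_le_mul_of_nonneg_left (stepLength_mul_le hσ hi k) hu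
        have h2 := mul_le_mul_of_nonneg_right (show u ≤ 1 by linarith) (hσ.2 k)
        linarith
      · simp [basicSolution_of_isNonbasic hj, edgeDirection_of_isNonbasic hj, hjq]
    · rintro ⟨hz, hz0⟩
      have hsum := eq_basicSolution_add_sum hσ.1 hz.1
      rw [Finset.sum_eq_single q (fun j _ hjq => ?_) (by simp)] at hsum
      · have hle : z q ≤ stepLength A b σ q i := by
          have h1 := hz.2 (σ i)
          rw [hsum, Pi.add_apply, Pi.smul_apply, basicSolution_basic hinj,
            edgeDirection_basic hinj hq, smul_eq_mul] at h1
          rw [stepLength, le_div_iff₀ hi.1]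
          linarith
        refine ⟨z q / stepLength A b σ q i, 1 - z q / stepLength A b σ q i,
          div_nonneg (hz.2 q) hpos.le, sub_nonneg.2 ((div_le_one hpos).2 hle), by ring, ?_⟩
        conv_rhs => rw [hsum]
        rw [smul_add, add_right_comm, ← add_smul, smul_smul, div_mul_cancel₀ _ hpos.ne',
          add_sub_cancel, one_smul]
      · by_cases hj : IsNonbasic σ j
        · rw [hz0 j hj hjq, zero_smul]
        · rw [edgeDirection_eq_zero hσ.1 hj, smul_zero]
  rw [hseg]
  refine ⟨fun z hz => hz.1, fun x hx y hy z hz hxyz => ⟨hx, fun j hj hjq => ?_⟩⟩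
  obtain ⟨u, v, hu, hv, -, rfl⟩ := hxyz
  have h0 := hz.2 j hj hjq
  simp only [Pi.add_apply, Pi.smul_apply, smul_eq_mul] at h0
  have h1 := mul_nonneg hv.le (hy.2 j)
  have h2 := hx.2 j
  nlinarith

end Basis

/-! ### Farkas' lemma, dual slacks and optimal vertices. -/

section Duality

/-- **Farkas' lemma** for finitely many linear functionals. -/
theorem farkas {V ι : Type*} [AddCommGroup V] [Module ℝ V] (s : Finset ι) (a : ι → V →ₗ[ℝ] ℝ)
    (f : V →ₗ[ℝ] ℝ) (h : ∀ x, (∀ i ∈ s, 0 ≤ a i x) → 0 ≤ f x) :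
    ∃ w : ι → ℝ, (∀ i, 0 ≤ w i) ∧ ∀ x, f x = ∑ i ∈ s, w i * a i x := by
  classical
  induction s using Finset.induction_on generalizing a f with
  | empty =>
    refine ⟨0, fun _ => le_rfl, fun x => ?_⟩
    have h1 := h x (by simp)
    have h2 := h (-x) (by simp)
    rw [map_neg] at h2
    rw [Finset.sum_empty]
    linarith
  | insert k s hk ih =>
    by_cases hs : ∀ x, (∀ i ∈ s, 0 ≤ a i x) → 0 ≤ f x
    · obtain ⟨w, hw, hf⟩ := ih a f hs
      refine ⟨Function.update w k 0, fun i => ?_, fun x => ?_⟩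
      · rcases eq_or_ne i k with rfl | hi
        · simp
        · simpa [hi] using hw i
      · rw [hf, Finset.sum_insert hk, Function.update_self, zero_mul, zero_add]
        refine Finset.sum_congr rfl fun i hi => ?_
        rw [Function.update_of_ne (ne_of_mem_of_not_mem hi hk)]
    · push Not at hs
      obtain ⟨z, hz, hfz⟩ := hs
      have hkz : a k z < 0 := by
        by_contra! hkz
        exact hfz.not_ge (h z (Finset.forall_mem_insert _ _ _ |>.2 ⟨hkz, hz⟩))
      have hne := hkz.ne
      -- `p g` is `g` precomposed with the projection along `z` onto the kernel of `a k`, which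
      -- reduces the problem to the functionals in `s`.
      let p (g : V →ₗ[ℝ] ℝ) : V →ₗ[ℝ] ℝ := g - (g z / a k z) • a k
      have hp (g : V →ₗ[ℝ] ℝ) (x : V) : p g x = g (x - (a k x / a k z) • z) := by
        simp only [p, LinearMap.sub_apply, LinearMap.smul_apply, smul_eq_mul, map_sub, map_smul]
        ring
      have hpk (x : V) : p (a k) x = 0 := by
        rw [hp, map_sub, map_smul, smul_eq_mul, div_mul_cancel₀ _ hne, sub_self]
      obtain ⟨w, hw, hf⟩ := ih (fun i => p (a i)) (p f) fun x hx => by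
        rw [hp]
        refine h _ (Finset.forall_mem_insert _ _ _ |>.2 ⟨?_, fun i hi => ?_⟩)
        · rw [← hp, hpk]
        · rw [← hp]
          exact hx i hi
      -- The coefficient of `a k` obtained by expanding `p f = ∑ w i • p (a i)`; its sign follows
      -- from `f z < 0`, `a k z < 0` and `a i z ≥ 0`.
      set r := f z / a k z - ∑ i ∈ s, w i * (a i z / a k z) with hr
      refine ⟨Function.update w k r, fun i => ?_, fun x => ?_⟩
      · rcases eq_or_ne i k with rfl | hi
        · rw [Function.update_self, hr]
          have h1 : 0 ≤ f z / a i z := (div_pos_of_neg_of_neg hfz hkz).le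
          have h2 : ∑ j ∈ s, w j * (a j z / a i z) ≤ 0 := Finset.sum_nonpos fun j hj =>
            mul_nonpos_of_nonneg_of_nonpos (hw j) (div_nonpos_of_nonneg_of_nonpos (hz j hj) hkz.le)
          linarith
        · simpa [hi] using hw i
      · rw [Finset.sum_insert hk, Function.update_self]
        have h1 : ∑ i ∈ s, Function.update w k r i * a i x = ∑ i ∈ s, w i * a i x :=
          Finset.sum_congr rfl fun i hi => by
            rw [Function.update_of_ne (ne_of_mem_of_not_mem hi hk)]
        have h2 := hf x
        simp only [p, LinearMap.sub_apply, LinearMap.smul_apply, smul_eq_mul, mul_sub,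
          Finset.sum_sub_distrib] at h2
        rw [h1, hr, sub_mul, Finset.sum_mul]
        simp only [mul_assoc] at h2 ⊢
        linarith

variable {A : Matrix (Fin m) (Fin n) ℝ} {b : Fin m → ℝ} {c : Fin n → ℝ}

/-- A step along a direction that keeps the equality constraints and does not decrease the
vanishing coordinates stays feasible for a short time. -/
theorem exists_add_smul_mem_feasible {x d : Fin n → ℝ} (hx : x ∈ feasible A b) (hd : A *ᵥ d = 0)
    (h : ∀ j, x j = 0 → 0 ≤ d j) : ∃ ε : ℝ, 0 < ε ∧ x + ε • d ∈ feasible A b := by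
  have h1 : ∀ j, ∀ᶠ ε : ℝ in nhdsWithin 0 (Set.Ioi 0), 0 ≤ x j + ε * d j := by
    intro j
    rcases (hx.2 j).eq_or_lt with h0 | h0
    · filter_upwards [self_mem_nhdsWithin] with ε hε
      rw [← h0, zero_add]
      exact mul_nonneg (le_of_lt hε) (h j h0.symm)
    · have hc : Filter.Tendsto (fun ε : ℝ => x j + ε * d j) (nhds 0) (nhds (x j + 0 * d j)) :=
        (continuous_const.add (continuous_id.mul continuous_const)).tendsto 0
      rw [zero_mul, add_zero] at hc
      exact nhdsWithin_le_nhds ((hc.eventually (lt_mem_nhds h0)).mono fun _ h => h.le)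
  obtain ⟨ε, hε, hε0⟩ := ((Filter.eventually_all.2 h1).and self_mem_nhdsWithin).exists
  refine ⟨ε, hε0, ?_, fun j => ?_⟩
  · rw [Matrix.mulVec_add, Matrix.mulVec_smul, hx.1, hd, smul_zero, add_zero]
  · exact hε j

/-- Linear programming duality with complementary slackness. -/
theorem exists_dual_slack {x : Fin n → ℝ} (hx : IsOptimal A b c x) :
    ∃ w : Fin n → ℝ, (∀ j, 0 ≤ w j) ∧ (∀ j, 0 < x j → w j = 0) ∧
      ∀ y ∈ feasible A b, c ⬝ᵥ y - c ⬝ᵥ x = ∑ j, w j * y j := by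
  classical
  -- Restricting Farkas to the kernel of `A` removes the free multipliers of the equations; using
  -- only the active constraints gives complementary slackness.
  let V := LinearMap.ker A.mulVecLin
  let S := Finset.univ.filter fun j => x j = 0
  obtain ⟨w, hw, hf⟩ := farkas S
    (fun j => (LinearMap.proj j : (Fin n → ℝ) →ₗ[ℝ] ℝ) ∘ₗ V.subtype)
    ((dotProductBilin ℝ ℝ c) ∘ₗ V.subtype) fun d hd => by
      have hd0 : A *ᵥ (d : Fin n → ℝ) = 0 := d.2
      obtain ⟨ε, hε, hmem⟩ := exists_add_smul_mem_feasible hx.1 hd0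
        fun j hj => hd j (by simpa [S] using hj)
      have := hx.2 _ hmem
      rw [dotProduct_add, dotProduct_smul, smul_eq_mul, le_add_iff_nonneg_right] at this
      exact nonneg_of_mul_nonneg_right this hε
  refine ⟨fun j => if x j = 0 then w j else 0, fun j => ?_, fun j hj => if_neg hj.ne',
    fun y hy => ?_⟩
  · dsimp only
    split_ifs
    exacts [hw j, le_rfl]
  · have hmem : y - x ∈ V := by
      rw [LinearMap.mem_ker, Matrix.mulVecLin_apply, Matrix.mulVec_sub, hy.1, hx.1.1, sub_self]
    have := hf ⟨y - x, hmem⟩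
    rw [← dotProduct_sub]
    refine this.trans ?_
    rw [Finset.sum_filter]
    refine Finset.sum_congr rfl fun j _ => ?_
    split_ifs with hj <;> simp [hj]

theorem isClosed_feasible (A : Matrix (Fin m) (Fin n) ℝ) (b : Fin m → ℝ) :
    IsClosed (feasible A b) := by
  rw [feasible, Set.ofPred_and, Set.ofPred_forall]
  exact (isClosed_eq (by fun_prop) continuous_const).inter
    (isClosed_iInter fun j => isClosed_le continuous_const (continuous_apply j))

/-- The optimal points form a compact extreme subset, whose extreme points are extreme in the whole
polytope. -/
theorem exists_isOptimal_extreme (hbdd : Bornology.IsBounded (feasible A b))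
    (hne : (feasible A b).Nonempty) (c : Fin n → ℝ) :
    ∃ x ∈ (feasible A b).extremePoints ℝ, IsOptimal A b c x := by
  have hcomp : IsCompact (feasible A b) := Metric.isCompact_of_isClosed_isBounded
    (isClosed_feasible A b) hbdd
  have hcont : Continuous fun x : Fin n → ℝ => c ⬝ᵥ x := by fun_prop
  obtain ⟨z, hz, hzmin⟩ := hcomp.exists_isMinOn hne hcont.continuousOn
  have hF : IsCompact (feasible A b ∩ {x | c ⬝ᵥ x ≤ c ⬝ᵥ z}) :=
    hcomp.inter_right (isClosed_le hcont continuous_const)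
  obtain ⟨x, hx⟩ := hF.extremePoints_nonempty ⟨z, hz, le_refl (c ⬝ᵥ z)⟩
  have hext : IsExtreme ℝ (feasible A b) (feasible A b ∩ {x | c ⬝ᵥ x ≤ c ⬝ᵥ z}) := by
    refine ⟨Set.inter_subset_left, fun u hu v hv w hw huvw => ⟨hu, ?_⟩⟩
    obtain ⟨p, q, hp, hq, hpq, rfl⟩ := huvw
    have h1 : c ⬝ᵥ (p • u + q • v) ≤ c ⬝ᵥ z := hw.2
    have h2 : c ⬝ᵥ z ≤ c ⬝ᵥ v := hzmin hv
    rw [dotProduct_add, dotProduct_smul, dotProduct_smul, smul_eq_mul, smul_eq_mul] at h1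
    have h3 := mul_le_mul_of_nonneg_left h2 hq.le
    obtain rfl : q = 1 - p := by linarith
    refine le_of_mul_le_mul_left ?_ hp
    linarith
  exact ⟨x, hext.extremePoints_subset_extremePoints hx, hx.1.1, fun y hy => hx.1.2.trans (hzmin hy)⟩

/-- A linear relation among the support columns is a direction in which `x` can move both ways. -/
theorem linearIndepOn_support_of_extreme {x : Fin n → ℝ}
    (hx : x ∈ (feasible A b).extremePoints ℝ) : LinearIndepOn ℝ A.col {j | 0 < x j} := by
  classical
  rw [linearIndepOn_iff]
  intro l hl hl0
  let d : Fin n → ℝ := l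
  have hAd : A *ᵥ d = 0 := by
    rw [Finsupp.linearCombination_apply, Finsupp.sum_fintype _ _ (by simp)] at hl0
    ext k
    have := congrFun hl0 k
    simpa [Matrix.mulVec, dotProduct, d, mul_comm, Matrix.col] using this
  have hd0 (j : Fin n) (hj : x j = 0) : d j = 0 := by
    by_contra hne
    have : 0 < x j := hl (Finsupp.mem_support_iff.2 hne)
    exact this.ne' hj
  obtain ⟨ε₁, hε₁, h₁⟩ := exists_add_smul_mem_feasible hx.1 hAd fun j hj => (hd0 j hj).ge
  obtain ⟨ε₂, hε₂, h₂⟩ := exists_add_smul_mem_feasible (d := -d) hx.1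
    (by rw [Matrix.mulVec_neg, hAd, neg_zero]) fun j hj => by simp [hd0 j hj]
  -- These weights make the two displacements `ε₁ • d` and `-ε₂ • d` cancel.
  have := hx.2 h₁ h₂ ⟨ε₂ / (ε₁ + ε₂), ε₁ / (ε₁ + ε₂), by positivity, by positivity,
    by field_simp; ring, by
      ext j
      simp only [Pi.add_apply, Pi.smul_apply, Pi.neg_apply, smul_eq_mul]
      field_simp
      ring⟩
  have hd : d = 0 := by simpa [hε₁.ne'] using this
  ext j
  exact congrFun hd j

/-- Extend the support columns to a basis of the column space; full row rank makes it consist of `m`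
columns. -/
theorem isBFS_of_extreme (hrank : A.rank = m) {x : Fin n → ℝ}
    (hx : x ∈ (feasible A b).extremePoints ℝ) : IsBFS A b x := by
  classical
  have hli := linearIndepOn_support_of_extreme hx
  set J := hli.extend (Set.subset_univ _) with hJ
  have hJli : LinearIndependent ℝ fun j : J => A.col j :=
    hli.linearIndepOn_extend (Set.subset_univ _)
  have hJspan : Submodule.span ℝ (A.col '' J) = Submodule.span ℝ (Set.range A.col) := by
    rw [hJ, hli.span_image_extend_eq_span_image, Set.image_univ]
  have hcard : Fintype.card J = m := by
    refine Eq.trans ?_ hrank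
    rw [← finrank_span_eq_card hJli, Matrix.rank_eq_finrank_span_cols, ← hJspan,
      Set.image_eq_range]
  let e : Fin m ≃ J := (Fintype.equivFinOfCardEq hcard).symm
  let σ : Fin m → Fin n := fun i => e i
  have hσ : IsUnit (basisMatrix A σ).det := by
    rw [← Matrix.isUnit_iff_isUnit_det, ← Matrix.linearIndependent_cols_iff_isUnit]
    exact hJli.comp e e.injective
  have hxσ : x = basicSolution A b σ := by
    refine eq_basicSolution hσ hx.1.1 fun j hj => ?_
    by_contra hne
    have hjJ : j ∈ J := hli.subset_extend _ ((hx.1.2 j).lt_of_ne' hne)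
    exact hj (e.symm ⟨j, hjJ⟩) (by simp [σ])
  refine ⟨σ, ⟨hσ, fun i => ?_⟩, hxσ⟩
  rw [← basicSolution_basic (injective_of_isUnit_det hσ), ← hxσ]
  exact hx.1.2 _

theorem exists_isOptimal_isBFS (hrank : A.rank = m) (hbdd : Bornology.IsBounded (feasible A b))
    (hne : (feasible A b).Nonempty) (c : Fin n → ℝ) : ∃ x, IsBFS A b x ∧ IsOptimal A b c x := by
  obtain ⟨x, hx, hopt⟩ := exists_isOptimal_extreme hbdd hne c
  exact ⟨x, isBFS_of_extreme hrank hx, hopt⟩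

end Duality

/-! ### Counting contractions per label. -/

section Counting

theorem le_pow_card_mul {N : Finset ℕ} {D : ℕ → ℝ} {ρ : ℝ} {T : ℕ} (hρ : ρ ≤ 1)
    (hstep : ∀ t ∈ N, D (t + 1) ≤ (1 - ρ) * D t) (hanti : ∀ t < T, D (t + 1) ≤ D t)
    {t t' : ℕ} (htt' : t ≤ t') (ht' : t' ≤ T) :
    D t' ≤ (1 - ρ) ^ (N.filter fun k => t ≤ k ∧ k < t').card * D t := by
  induction t', htt' using Nat.le_induction with
  | base =>
    rw [Finset.filter_false_of_mem (fun k _ h => by omega)]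
    simp
  | succ r hr ih =>
    have ih := ih (by omega)
    by_cases hrN : r ∈ N
    · have hset : (N.filter fun k => t ≤ k ∧ k < r + 1) =
          insert r (N.filter fun k => t ≤ k ∧ k < r) := by
        ext k
        simp only [Finset.mem_filter, Finset.mem_insert]
        constructor
        · rintro ⟨h1, h2, h3⟩
          by_cases hk : k = r
          · exact Or.inl hk
          · exact Or.inr ⟨h1, h2, by omega⟩
        · rintro (rfl | ⟨h1, h2, h3⟩)
          · exact ⟨hrN, hr, by omega⟩
          · exact ⟨h1, h2, by omega⟩
      rw [hset, Finset.card_insert_of_notMem (by simp), pow_succ', mul_assoc]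
      exact (hstep r hrN).trans (mul_le_mul_of_nonneg_left ih (sub_nonneg.2 hρ))
    · have hset : (N.filter fun k => t ≤ k ∧ k < r + 1) = N.filter fun k => t ≤ k ∧ k < r := by
        refine Finset.filter_congr fun k hk => ?_
        have : k ≠ r := ne_of_mem_of_not_mem hk hrN
        omega
      rw [hset]
      exact (hanti r (by omega)).trans ih

/-- If a positive nonincreasing quantity contracts at the times in `N`, and cannot drop below
a fraction of its value between two times with the same label, then few times occur per label. -/
theorem card_le_of_contraction {ι : Type*} [DecidableEq ι] {N : Finset ℕ} {D : ℕ → ℝ} {ρ κ : ℝ}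
    {T K : ℕ} {f : ℕ → ι} {S : Finset ι} (hρ0 : 0 ≤ ρ) (hρ : ρ ≤ 1) (hNT : ∀ t ∈ N, t < T)
    (hstep : ∀ t ∈ N, D (t + 1) ≤ (1 - ρ) * D t) (hanti : ∀ t < T, D (t + 1) ≤ D t)
    (hpos : ∀ t ∈ N, 0 < D t) (hK : (1 - ρ) ^ K < κ) (hf : ∀ t ∈ N, f t ∈ S)
    (hlabel : ∀ t ∈ N, ∀ t' ∈ N, f t = f t' → κ * D t ≤ D t') :
    N.card ≤ K * S.card := by
  refine Finset.card_le_mul_card_image_of_maps_to hf K fun j _ => ?_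
  rcases (N.filter fun t => f t = j).eq_empty_or_nonempty with hF | hF
  · simp [hF]
  set F := N.filter fun t => f t = j
  set a := F.min' hF
  set z := F.max' hF
  obtain ⟨haN, haj⟩ := Finset.mem_filter.1 (F.min'_mem hF)
  obtain ⟨hzN, hzj⟩ := Finset.mem_filter.1 (F.max'_mem hF)
  -- Only times before `z` contract between `a` and `z`, so more than `K` elements of `F` still
  -- force at least `K` contractions.
  have hsub : F ⊆ insert z (N.filter fun k => a ≤ k ∧ k < z) := by
    intro k hk
    rw [Finset.mem_insert, Finset.mem_filter]
    rcases (F.le_max' k hk).eq_or_lt with h | h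
    · exact Or.inl h
    · exact Or.inr ⟨(Finset.mem_filter.1 hk).1, F.min'_le k hk, h⟩
  refine (Finset.card_le_card hsub).trans ((Finset.card_insert_le _ _).trans ?_)
  by_contra! hcard
  have h1 := le_pow_card_mul hρ hstep hanti (F.min'_le z (F.max'_mem hF)) (hNT z hzN).le
  have h2 : (1 - ρ) ^ (N.filter fun k => a ≤ k ∧ k < z).card ≤ (1 - ρ) ^ K :=
    pow_le_pow_of_le_one (by linarith) (by linarith) (by omega)
  have h3 := hlabel a haN z hzN (haj.trans hzj.symm)
  have h4 := mul_lt_mul_of_pos_right (h2.trans_lt hK) (hpos a haN)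
  linarith

/-- Strictness comes from `1 - ρ < exp (-ρ)` and needs `K ≠ 0`; hence the maximum with `1` in the
bound. -/
theorem one_sub_pow_lt_inv {ρ R : ℝ} {K : ℕ} (hρ0 : 0 < ρ) (hρ : ρ ≤ 1) (hR : 0 < R) (hK : K ≠ 0)
    (hKR : Real.log R ≤ ρ * K) : (1 - ρ) ^ K < R⁻¹ := by
  have h1 : 1 - ρ < Real.exp (-ρ) := by
    have := Real.add_one_lt_exp (x := -ρ) (by linarith)
    linarith
  calc (1 - ρ) ^ K < Real.exp (-ρ) ^ K := pow_lt_pow_left₀ h1 (by linarith) hK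
    _ = Real.exp (-(ρ * K)) := by rw [← Real.exp_nat_mul]; ring_nf
    _ ≤ Real.exp (-Real.log R) := Real.exp_le_exp.2 (by linarith)
    _ = R⁻¹ := by rw [Real.exp_neg, Real.exp_log hR]

end Counting

/-! ### Contraction of the gap and the final bounds. -/

section Bounds

variable {A : Matrix (Fin m) (Fin n) ℝ} {b : Fin m → ℝ} {c : Fin n → ℝ} {σ : Fin m → Fin n}
  {q : Fin n} {i : Fin m} {γ δ : ℝ}

theorem dotProduct_basicSolution (g : Fin n → ℝ) (σ : Fin m → Fin n) :
    g ⬝ᵥ basicSolution A b σ = ∑ i, g (σ i) * basicValues A b σ i := by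
  simp only [dotProduct, basicSolution, extendByZero, Finset.mul_sum, mul_ite, mul_zero]
  rw [Finset.sum_comm]
  simp

theorem basicSolution_le (hγ0 : 0 ≤ γ) (hγ : γ ∈ upperBounds (positiveBFSCoords A b))
    (hσ : IsFeasibleBasis A b σ) (j : Fin n) : basicSolution A b σ j ≤ γ := by
  rcases le_or_gt (basicSolution A b σ j) 0 with h | h
  · exact h.trans hγ0
  · exact hγ ⟨_, j, ⟨σ, hσ, rfl⟩, rfl, h⟩

/-- Only the `m` basic coordinates contribute, each at most `γ`. -/
theorem sum_le_of_isBFS (hγ0 : 0 ≤ γ) (hγ : γ ∈ upperBounds (positiveBFSCoords A b))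
    {z : Fin n → ℝ} (hz : IsBFS A b z) : ∑ j, z j ≤ m * γ := by
  obtain ⟨σ, hσ, rfl⟩ := hz
  have h := dotProduct_basicSolution (A := A) (b := b) 1 σ
  rw [one_dotProduct] at h
  rw [h]
  refine (Finset.sum_le_card_nsmul Finset.univ _ γ fun i _ => ?_).trans (by simp)
  rw [Pi.one_apply, one_mul, ← basicSolution_basic (injective_of_isUnit_det hσ.1)]
  exact basicSolution_le hγ0 hγ hσ _

theorem dotProduct_basicSolution_update (hσ : IsFeasibleBasis A b σ) (hq : IsNonbasic σ q)
    (hi : RatioTestLeaving A b σ q i) :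
    c ⬝ᵥ basicSolution A b (Function.update σ i q) =
      c ⬝ᵥ basicSolution A b σ + stepLength A b σ q i * reducedCost A c σ q := by
  rw [basicSolution_update hσ hq hi, dotProduct_add, dotProduct_smul, smul_eq_mul, reducedCost]

theorem stepLength_pos_of_ne (hσ : IsFeasibleBasis A b σ) (hq : IsNonbasic σ q)
    (hi : RatioTestLeaving A b σ q i)
    (hne : basicSolution A b (Function.update σ i q) ≠ basicSolution A b σ) :
    0 < stepLength A b σ q i := by
  refine (stepLength_nonneg hσ hi).lt_of_ne' fun h => hne ?_
  rw [basicSolution_update hσ hq hi, h, zero_smul, add_zero]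

/-- A steepest-edge pivot contracts the optimality gap. -/
theorem gap_update_le (hγ0 : 0 < m * γ) (hσ : IsFeasibleBasis A b σ)
    (hq : SteepestEdgeEntering A c σ q) (hi : RatioTestLeaving A b σ q i) {L M : ℝ}
    (hM0 : 0 ≤ M) (hL0 : 0 < L) (hL : ∀ r, IsNonbasic σ r → edgeNorm A σ r ≤ L)
    (hM : M ≤ stepLength A b σ q i * edgeNorm A σ q)
    {z : Fin n → ℝ} (hz : z ∈ feasible A b) (hzsum : ∑ j, z j ≤ m * γ) :
    c ⬝ᵥ basicSolution A b (Function.update σ i q) - c ⬝ᵥ z ≤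
      (1 - M / (m * γ * L)) * (c ⬝ᵥ basicSolution A b σ - c ⬝ᵥ z) := by
  obtain ⟨hqn, hneg, hmin⟩ := hq
  have hζ : 0 < edgeNorm A σ q := zero_lt_one.trans_le (one_le_edgeNorm hqn)
  -- Objective decrease per unit of Euclidean length along the chosen edge.
  set Δ := -(reducedCost A c σ q / edgeNorm A σ q) with hΔ
  have hΔ0 : 0 < Δ := neg_pos.2 (div_neg_of_neg_of_pos hneg hζ)
  have hred : reducedCost A c σ q = -(Δ * edgeNorm A σ q) := by
    rw [hΔ]
    field_simp
  have hterm (j : Fin n) : -(Δ * L) * z j ≤ z j * reducedCost A c σ j := by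
    by_cases hj : IsNonbasic σ j
    · have hζj : 0 < edgeNorm A σ j := zero_lt_one.trans_le (one_le_edgeNorm hj)
      have h1 := hmin j hj
      rw [le_div_iff₀ hζj] at h1
      have h2 := mul_le_mul_of_nonneg_left (hL j hj) hΔ0.le
      rw [mul_comm]
      refine mul_le_mul_of_nonneg_left ?_ (hz.2 j)
      have h3 : reducedCost A c σ q / edgeNorm A σ q = -Δ := by rw [hΔ, neg_neg]
      rw [h3] at h1
      linarith
    · have h0 : reducedCost A c σ j = 0 := by
        rw [reducedCost, edgeDirection_eq_zero hσ.1 hj, dotProduct_zero]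
      rw [h0, mul_zero]
      exact mul_nonpos_of_nonpos_of_nonneg (by have := mul_pos hΔ0 hL0; linarith) (hz.2 j)
  have hgap : c ⬝ᵥ basicSolution A b σ - c ⬝ᵥ z ≤ Δ * (m * γ * L) := by
    have h1 := Finset.sum_le_sum fun j (_ : j ∈ Finset.univ) => hterm j
    rw [← Finset.mul_sum] at h1
    have h2 := mul_le_mul_of_nonneg_left hzsum (mul_pos hΔ0 hL0).le
    rw [dotProduct_eq_add_sum hσ.1 c hz.1]
    linarith
  have hmul := mul_le_mul_of_nonneg_left hgap (div_nonneg hM0 (mul_pos hγ0 hL0).le)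
  have hcancel : M / (m * γ * L) * (Δ * (m * γ * L)) = Δ * M := by
    have := (mul_pos hγ0 hL0).ne'
    rw [mul_comm Δ, ← mul_assoc, div_mul_cancel₀ _ this, mul_comm]
  have hdec := mul_le_mul_of_nonneg_left hM hΔ0.le
  rw [dotProduct_basicSolution_update hσ hqn hi, hred]
  linarith

/-- A degenerate pivot repeats the current solution. -/
theorem generatedBFS_subset (A : Matrix (Fin m) (Fin n) ℝ) (b : Fin m → ℝ) (T : ℕ)
    (s : ℕ → Fin m → Fin n) :
    generatedBFS A b T s ⊆ insert (basicSolution A b (s 0))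
      ((fun t => basicSolution A b (s (t + 1))) '' nondegeneratePivots A b T s) := by
  rintro x ⟨t, ht, rfl⟩
  induction t with
  | zero => exact Set.mem_insert _ _
  | succ t ih =>
    by_cases h : basicSolution A b (s (t + 1)) = basicSolution A b (s t)
    · rw [h]
      exact ih (by omega)
    · exact Set.mem_insert_of_mem _ ⟨t, ⟨ht, h⟩, rfl⟩

theorem ncard_generatedBFS_le (A : Matrix (Fin m) (Fin n) ℝ) (b : Fin m → ℝ) (T : ℕ)
    (s : ℕ → Fin m → Fin n) :
    (generatedBFS A b T s).ncard ≤ (nondegeneratePivots A b T s).ncard + 1 := by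
  have hfin : (nondegeneratePivots A b T s).Finite :=
    (Set.finite_Iio T).subset fun t ht => ht.1
  calc _ ≤ _ := Set.ncard_le_ncard (generatedBFS_subset A b T s) ((hfin.image _).insert _)
    _ ≤ _ := Set.ncard_insert_le _ _
    _ ≤ _ := Nat.add_le_add_right (Set.ncard_image_le hfin) 1

/-- If `0` were feasible, then `b = 0` and every BFS would vanish. Applied to the optimum, this
yields the coordinate that is never a label. -/
theorem exists_pos_of_positiveBFSCoords (hne : (positiveBFSCoords A b).Nonempty)
    {z : Fin n → ℝ} (hz : z ∈ feasible A b) : ∃ j, 0 < z j := by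
  by_contra! h
  have hz0 : z = 0 := funext fun j => le_antisymm (h j) (hz.2 j)
  have hb : b = 0 := by rw [← hz.1, hz0, Matrix.mulVec_zero]
  obtain ⟨_, x, j, ⟨σ, hσ, rfl⟩, rfl, hpos⟩ := hne
  simp [basicSolution, basicValues, extendByZero, hb] at hpos

theorem exists_le_mul_basicSolution (hm : 0 < m) (w : Fin n → ℝ)
    (hσ : Function.Injective σ) :
    ∃ j, w ⬝ᵥ basicSolution A b σ ≤ m * (w j * basicSolution A b σ j) := by
  have : NeZero m := ⟨hm.ne'⟩
  have hm' : (0 : ℝ) < m := by exact_mod_cast hm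
  obtain ⟨i, -, hi⟩ := Finset.exists_le_of_sum_le (s := (Finset.univ : Finset (Fin m)))
    (f := fun _ => w ⬝ᵥ basicSolution A b σ / m) (g := fun i => w (σ i) * basicValues A b σ i)
    Finset.univ_nonempty (by
      rw [← dotProduct_basicSolution]
      simp only [Finset.sum_const, Finset.card_univ, Fintype.card_fin, nsmul_eq_mul]
      rw [mul_div_cancel₀ _ hm'.ne'])
  refine ⟨σ i, ?_⟩
  rw [basicSolution_basic hσ]
  rwa [div_le_iff₀' hm'] at hi

theorem pos_of_positiveBFSCoords (hne : (positiveBFSCoords A b).Nonempty) : 0 < m := by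
  obtain ⟨_, x, j, ⟨σ, hσ, rfl⟩, rfl, hpos⟩ := hne
  rcases m.eq_zero_or_pos with rfl | h
  · simp [basicSolution, extendByZero] at hpos
  · exact h

/-! ### Runs of the method. -/

variable {T : ℕ} {s : ℕ → Fin m → Fin n}

theorem dotProduct_basicSolution_succ_le (hs : IsSteepestEdgeRun A b c T s) {t : ℕ} (ht : t < T) :
    c ⬝ᵥ basicSolution A b (s (t + 1)) ≤ c ⬝ᵥ basicSolution A b (s t) := by
  have hσ := isFeasibleBasis_of_isSteepestEdgeRun hs ht.le
  obtain ⟨q, i, hq, hi, h⟩ := hs.2 t ht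
  rw [h, dotProduct_basicSolution_update hσ hq.1 hi]
  have := mul_nonpos_of_nonneg_of_nonpos (stepLength_nonneg hσ hi) hq.2.1.le
  linarith

theorem dotProduct_basicSolution_succ_lt (hs : IsSteepestEdgeRun A b c T s) {t : ℕ}
    (ht : t ∈ nondegeneratePivots A b T s) :
    c ⬝ᵥ basicSolution A b (s (t + 1)) < c ⬝ᵥ basicSolution A b (s t) := by
  have hσ := isFeasibleBasis_of_isSteepestEdgeRun hs ht.1.le
  obtain ⟨q, i, hq, hi, h⟩ := hs.2 t ht.1
  have hne := ht.2
  rw [h] at hne ⊢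
  rw [dotProduct_basicSolution_update hσ hq.1 hi]
  have := mul_neg_of_pos_of_neg (stepLength_pos_of_ne hσ hq.1 hi hne) hq.2.1
  linarith

/-- A contraction of the optimality gap at every nondegenerate pivot bounds their number. -/
theorem ncard_nondegeneratePivots_le (hγ : IsGreatest (positiveBFSCoords A b) γ)
    (hδ : IsLeast (positiveBFSCoords A b) δ) (hs : IsSteepestEdgeRun A b c T s)
    {z : Fin n → ℝ} (hz : IsOptimal A b c z) {ρ : ℝ} {K : ℕ} (hρ0 : 0 ≤ ρ) (hρ : ρ ≤ 1)
    (hK : (1 - ρ) ^ K < (m * γ / δ)⁻¹)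
    (hcontr : ∀ t ∈ nondegeneratePivots A b T s,
      c ⬝ᵥ basicSolution A b (s (t + 1)) - c ⬝ᵥ z ≤
        (1 - ρ) * (c ⬝ᵥ basicSolution A b (s t) - c ⬝ᵥ z)) :
    (nondegeneratePivots A b T s).ncard ≤ K * (n - 1) := by
  classical
  have hne : (positiveBFSCoords A b).Nonempty := ⟨γ, hγ.1⟩
  have hm := pos_of_positiveBFSCoords hne
  have hγ0 : 0 < γ := by obtain ⟨_, _, _, _, h⟩ := hγ.1; exact h
  have hδ0 : 0 < δ := by obtain ⟨_, _, _, _, h⟩ := hδ.1; exact h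
  have hm' : (0 : ℝ) < m := by exact_mod_cast hm
  have hfeas {t : ℕ} (ht : t ≤ T) := isFeasibleBasis_of_isSteepestEdgeRun hs ht
  obtain ⟨w, hw, hslack, hgap⟩ := exists_dual_slack hz
  obtain ⟨j₀, hj₀⟩ := exists_pos_of_positiveBFSCoords hne hz.1
  set D : ℕ → ℝ := fun t => c ⬝ᵥ basicSolution A b (s t) - c ⬝ᵥ z with hD
  have hDw {t : ℕ} (ht : t ≤ T) : D t = w ⬝ᵥ basicSolution A b (s t) :=
    hgap _ (basicSolution_mem_feasible (hfeas ht))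
  have : Nonempty (Fin n) := ⟨j₀⟩
  choose! f hf using fun t (ht : t ≤ T) => exists_le_mul_basicSolution (A := A) (b := b) hm w
    (injective_of_isUnit_det (hfeas ht).1)
  obtain ⟨N, hN⟩ : ∃ N : Finset ℕ, ↑N = nondegeneratePivots A b T s :=
    ((Set.finite_Iio T).subset fun t ht => ht.1).exists_finset_coe
  have hmem {t : ℕ} : t ∈ N ↔ t ∈ nondegeneratePivots A b T s := by rw [← hN, Finset.mem_coe]
  have hNT (t : ℕ) (ht : t ∈ N) : t < T := (hmem.1 ht).1
  have hpos (t : ℕ) (ht : t ∈ N) : 0 < D t := by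
    have h1 := dotProduct_basicSolution_succ_lt hs (hmem.1 ht)
    have h2 := hz.2 _ (basicSolution_mem_feasible (hfeas (hNT t ht)))
    simp only [hD]
    linarith
  have hprod (t : ℕ) (ht : t ∈ N) : 0 < w (f t) * basicSolution A b (s t) (f t) := by
    have h := hf t (hNT t ht).le
    rw [← hDw (hNT t ht).le] at h
    exact pos_of_mul_pos_right ((hpos t ht).trans_le h) hm'.le
  rw [← hN, Set.ncard_coe_finset]
  refine (card_le_of_contraction (S := Finset.univ.erase j₀) (f := f) (D := D) hρ0 hρ hNT
    (fun t ht => hcontr t (hmem.1 ht)) (fun t ht => ?_) hpos hK (fun t ht => ?_)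
    fun t ht t' ht' hff => ?_).trans_eq (by simp)
  · exact sub_le_sub_right (dotProduct_basicSolution_succ_le hs ht) _
  -- Complementary slackness gives `w j₀ = 0`, whereas a label carries a positive share of the gap.
  · refine Finset.mem_erase.2 ⟨fun h => ?_, Finset.mem_univ _⟩
    have := hprod t ht
    rw [h, hslack j₀ hj₀, zero_mul] at this
    exact this.false
  · have hfe' := hfeas (hNT t' ht').le
    have hx' : 0 < basicSolution A b (s t') (f t') :=
      pos_of_mul_pos_right (hprod t' ht') (hw _)
    have hle : D t ≤ m * (w (f t) * γ) := by
      rw [hDw (hNT t ht).le]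
      refine (hf t (hNT t ht).le).trans ?_
      gcongr
      · exact hw _
      · exact basicSolution_le hγ0.le hγ.2 (hfeas (hNT t ht).le) _
    have hge : w (f t) * δ ≤ D t' := by
      rw [hDw (hNT t' ht').le, hff]
      refine (mul_le_mul_of_nonneg_left (hδ.2 ⟨_, f t', ⟨_, hfe', rfl⟩, rfl, hx'⟩) (hw _)).trans ?_
      exact Finset.single_le_sum (f := fun j => w j * basicSolution A b (s t') j)
        (fun j _ => mul_nonneg (hw j) (basicSolution_nonneg hfe' j)) (Finset.mem_univ _)
    refine le_trans ?_ hge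
    rw [inv_div, div_mul_eq_mul_div, div_le_iff₀ (by positivity)]
    have := mul_le_mul_of_nonneg_left hle hδ0.le
    linarith

/-- The two bounds, when all edge norms are at most `L`, all nondegenerate pivots move by at least
`M`, and `L / M = ν / (δ * μ)`. -/
theorem ncard_le_steepestEdgeBound (hrank : A.rank = m)
    (hbdd : Bornology.IsBounded (feasible A b)) (hγ : IsGreatest (positiveBFSCoords A b) γ)
    (hδ : IsLeast (positiveBFSCoords A b) δ) (hs : IsSteepestEdgeRun A b c T s) {ν μ L M : ℝ}
    (hμ : 0 < μ) (hμν : μ ≤ ν) (hL0 : 0 < L) (hM0 : 0 < M) (hLM : M * ν = L * (δ * μ))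
    (hL : ∀ σ r, IsFeasibleBasis A b σ → IsNonbasic σ r → edgeNorm A σ r ≤ L)
    (hM : ∀ σ q i, IsFeasibleBasis A b σ → IsNonbasic σ q → RatioTestLeaving A b σ q i →
      0 < stepLength A b σ q i → M ≤ stepLength A b σ q i * edgeNorm A σ q) :
    (generatedBFS A b T s).ncard ≤ steepestEdgeBound m n γ δ ν μ ∧
      (nondegeneratePivots A b T s).ncard ≤ steepestEdgeBound m n γ δ ν μ := by
  have hne : (positiveBFSCoords A b).Nonempty := ⟨γ, hγ.1⟩
  have hγ0 : 0 < γ := by obtain ⟨_, _, _, _, h⟩ := hγ.1; exact h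
  have hδ0 : 0 < δ := by obtain ⟨_, _, _, _, h⟩ := hδ.1; exact h
  have hδγ : δ ≤ γ := hδ.2 hγ.1
  have hν : 0 < ν := hμ.trans_le hμν
  have hm : (1 : ℝ) ≤ m := by exact_mod_cast pos_of_positiveBFSCoords hne
  obtain ⟨z, hzB, hz⟩ := exists_isOptimal_isBFS hrank hbdd ⟨_, basicSolution_mem_feasible hs.1⟩ c
  set K := max 1 ⌈(m * γ * ν) / (δ * μ) * Real.log (m * γ / δ)⌉₊ with hK
  have hK1 : 1 ≤ K := le_max_left _ _
  set ρ := M / (m * γ * L) with hρdef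
  have hρ : ρ = (δ * μ) / (m * γ * ν) := by
    rw [hρdef, div_eq_div_iff (by positivity) (by positivity)]
    linear_combination (m * γ) * hLM
  have hρ0 : 0 < ρ := by positivity
  have hρ1 : ρ ≤ 1 := by
    rw [hρ, div_le_one (by positivity)]
    have h1 : γ ≤ m * γ := le_mul_of_one_le_left hγ0.le hm
    exact mul_le_mul (hδγ.trans h1) hμν hμ.le (by positivity)
  have hpow : (1 - ρ) ^ K < (m * γ / δ)⁻¹ := by
    refine one_sub_pow_lt_inv hρ0 hρ1 (by positivity) (by omega) ?_
    have h1 : (m * γ * ν) / (δ * μ) * Real.log (m * γ / δ) ≤ K :=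
      (Nat.le_ceil _).trans (by exact_mod_cast le_max_right _ _)
    have h2 := mul_le_mul_of_nonneg_left h1 hρ0.le
    rw [← mul_assoc] at h2
    have h3 : ρ * ((m * γ * ν) / (δ * μ)) = 1 := by
      rw [hρ]
      field_simp
    rwa [h3, one_mul] at h2
  have hcard := ncard_nondegeneratePivots_le hγ hδ hs hz hρ0.le hρ1 hpow fun t ht => by
    have hσ := isFeasibleBasis_of_isSteepestEdgeRun hs ht.1.le
    obtain ⟨q, i, hq, hi, h⟩ := hs.2 t ht.1
    have hne := ht.2
    rw [h] at hne ⊢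
    exact gap_update_le (by positivity) hσ hq hi hM0.le hL0 (fun r hr => hL _ r hσ hr)
      (hM _ q i hσ hq.1 hi (stepLength_pos_of_ne hσ hq.1 hi hne)) hz.1
      (sum_le_of_isBFS hγ0.le hγ.2 hzB)
  have hn : 1 ≤ n := by
    obtain ⟨_, j, _⟩ := hγ.1
    exact j.pos
  have hmul : K * (n - 1) + K = steepestEdgeBound m n γ δ ν μ := by
    obtain ⟨k, rfl⟩ : ∃ k, n = k + 1 := ⟨n - 1, by omega⟩
    rw [steepestEdgeBound, ← hK]
    simp only [Nat.add_sub_cancel]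
    ring
  -- The excluded label leaves `K ≥ 1` to spare, which absorbs the starting BFS.
  exact ⟨(ncard_generatedBFS_le A b T s).trans (by omega), by omega⟩

theorem ncard_le_of_edgeNorms (hrank : A.rank = m)
    (hbdd : Bornology.IsBounded (feasible A b)) (hγ : IsGreatest (positiveBFSCoords A b) γ)
    (hδ : IsLeast (positiveBFSCoords A b) δ) (hs : IsSteepestEdgeRun A b c T s) {ν μ : ℝ}
    (hν : IsGreatest (edgeNorms A b) ν) (hμ : IsLeast (edgeNorms A b) μ) :
    (generatedBFS A b T s).ncard ≤ steepestEdgeBound m n γ δ ν μ ∧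
      (nondegeneratePivots A b T s).ncard ≤ steepestEdgeBound m n γ δ ν μ := by
  have hδ0 : 0 < δ := by obtain ⟨_, _, _, _, h⟩ := hδ.1; exact h
  have hμ0 : 0 < μ := by
    obtain ⟨σ, q, -, hq, rfl⟩ := hμ.1
    exact zero_lt_one.trans_le (one_le_edgeNorm hq)
  have hμν : μ ≤ ν := hμ.2 hν.1
  -- Here `L = ν` and `M = δ * μ`: a positive step length is at least `δ`, an edge norm at least
  -- `μ`.
  refine ncard_le_steepestEdgeBound hrank hbdd hγ hδ hs hμ0 hμν (hμ0.trans_le hμν)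
    (mul_pos hδ0 hμ0) (mul_comm _ _) (fun σ r hσ hr => hν.2 ⟨σ, r, hσ, hr, rfl⟩)
    fun σ q i hσ hq hi hpos => ?_
  exact mul_le_mul (le_stepLength hδ.2 hσ hq hi hpos) (hμ.2 ⟨σ, q, hσ, hq, rfl⟩) hμ0.le hpos.le

theorem stepLength_mul_edgeNorm_mem (hσ : IsFeasibleBasis A b σ) (hq : IsNonbasic σ q)
    (hi : RatioTestLeaving A b σ q i) (hpos : 0 < stepLength A b σ q i) :
    stepLength A b σ q i * edgeNorm A σ q ∈ polytopeEdgeLengths A b := by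
  refine ⟨_, _, fun h => ?_, isExtreme_segment hσ hq hi hpos, ?_⟩
  · have := congrFun h q
    simp [edgeDirection_self hq, hpos.ne'] at this
  · rw [add_sub_cancel_left, WithLp.toLp_smul, norm_smul, Real.norm_of_nonneg hpos.le, edgeNorm]

theorem ncard_le_of_polytopeEdgeLengths (hrank : A.rank = m)
    (hbdd : Bornology.IsBounded (feasible A b)) (hγ : IsGreatest (positiveBFSCoords A b) γ)
    (hδ : IsLeast (positiveBFSCoords A b) δ) (hs : IsSteepestEdgeRun A b c T s)
    (hnd : Nondegenerate A b) {ν μ : ℝ} (hν : IsGreatest (polytopeEdgeLengths A b) ν)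
    (hμ : IsLeast (polytopeEdgeLengths A b) μ) :
    (generatedBFS A b T s).ncard ≤ steepestEdgeBound m n γ δ ν μ ∧
      (nondegeneratePivots A b T s).ncard ≤ steepestEdgeBound m n γ δ ν μ := by
  have hδ0 : 0 < δ := by obtain ⟨_, _, _, _, h⟩ := hδ.1; exact h
  have hμ0 : 0 < μ := by
    obtain ⟨x, y, hxy, -, rfl⟩ := hμ.1
    rw [norm_pos_iff, Ne, WithLp.toLp_eq_zero, sub_eq_zero]
    exact hxy
  have hμν : μ ≤ ν := hμ.2 hν.1
  -- A nondegenerate pivot traverses an edge, so `M = μ`. Nondegeneracy gives every nonbasic column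
  -- a step of length at least `δ` along an edge, so `δ` times its norm is at most `ν`.
  refine ncard_le_steepestEdgeBound hrank hbdd hγ hδ hs (L := ν / δ) (M := μ) hμ0 hμν
    (div_pos (hμ0.trans_le hμν) hδ0) hμ0 (by field_simp) (fun σ r hσ hr => ?_)
    fun σ q i hσ hq hi hpos => hμ.2 (stepLength_mul_edgeNorm_mem hσ hq hi hpos)
  obtain ⟨i, hi⟩ := exists_ratioTestLeaving hbdd hσ hr
  have hpos : 0 < stepLength A b σ r i := div_pos (hnd σ hσ i) hi.1
  rw [le_div_iff₀' hδ0]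
  have h1 := le_stepLength hδ.2 hσ hr hi hpos
  exact (mul_le_mul_of_nonneg_right h1 (zero_le_one.trans (one_le_edgeNorm hr))).trans
    (hν.2 (stepLength_mul_edgeNorm_mem hσ hr hi hpos))

end Bounds

end StdLP

/-- Since `T` is arbitrary and the bounds do not depend on it, infinite runs are covered through
their prefixes. Both counted sets are finite, so `ncard` is their true size. -/
theorem mainTheorem11 {m n : ℕ} (hmn : m < n)
    (A : Matrix (Fin m) (Fin n) ℝ) (b : Fin m → ℝ) (c : Fin n → ℝ)
    (hrank : A.rank = m) (hbdd : Bornology.IsBounded (StdLP.feasible A b))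
    (T : ℕ) (s : ℕ → Fin m → Fin n) (hs : StdLP.IsSteepestEdgeRun A b c T s) :
    (∀ γ δ : ℝ, IsGreatest (StdLP.positiveBFSCoords A b) γ →
      IsLeast (StdLP.positiveBFSCoords A b) δ →
      (∀ ν μ : ℝ, IsGreatest (StdLP.edgeNorms A b) ν → IsLeast (StdLP.edgeNorms A b) μ →
        (StdLP.generatedBFS A b T s).ncard ≤ StdLP.steepestEdgeBound m n γ δ ν μ ∧
        (StdLP.nondegeneratePivots A b T s).ncard ≤ StdLP.steepestEdgeBound m n γ δ ν μ) ∧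
      (StdLP.Nondegenerate A b → ∀ ν μ : ℝ,
        IsGreatest (StdLP.polytopeEdgeLengths A b) ν →
        IsLeast (StdLP.polytopeEdgeLengths A b) μ →
        (StdLP.generatedBFS A b T s).ncard ≤ StdLP.steepestEdgeBound m n γ δ ν μ ∧
        (StdLP.nondegeneratePivots A b T s).ncard ≤ StdLP.steepestEdgeBound m n γ δ ν μ)) ∧
    ((∀ σ, ¬ StdLP.SteepestEdgePivot A b c (s T) σ) →
      StdLP.IsOptimal A b c (StdLP.basicSolution A b (s T))) := by
  refine ⟨fun γ δ hγ hδ => ⟨fun ν μ hν hμ => ?_, fun hnd ν μ hν hμ => ?_⟩, fun hfinal => ?_⟩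
  · exact StdLP.ncard_le_of_edgeNorms hrank hbdd hγ hδ hs hν hμ
  · exact StdLP.ncard_le_of_polytopeEdgeLengths hrank hbdd hγ hδ hs hnd hν hμ
  · exact StdLP.isOptimal_of_forall_not_pivot hbdd
      (StdLP.isFeasibleBasis_of_isSteepestEdgeRun hs le_rfl) hfinal
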